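/- Notation. Write $\langle\xi\rangle=(1+\xi^2)^{1/2}$, $\hat u(\xi)=(2\pi)^{-1/2}\int_{\mathbb R} e^{-ix\xi}u(x)\,dx$, and $P_4=\{\xi\in\mathbb R^4:\ \xi_1+\xi_2+\xi_3+\xi_4=0\}$ with the measure $d\sigma=\delta(\xi_1+\xi_2+\xi_3+\xi_4)\,d\xi$ (that is, $d\xi_1\,d\xi_2\,d\xi_3$). Fix constants $(c_\alpha)_{\alpha\ge 0}$. For $M\ge 1$ let $S_M$ be the class of real, smooth, positive, even functions $a$ on $\mathbb R$ such that (i) $a$ is constant on $\{|\xi|\le M\}$; (ii) $|\partial_\xi^\alpha a(\xi)|\le c_\alpha\, a(\xi)\,\langle\xi\rangle^{-\alpha}$ for all $\alpha\ge 0$ and $\xi\in\mathbb R$; (iii) $-\tfrac12\le \dfrac{d\log a(\xi)}{d\log(1+\xi^2)}\le 0$. For $a\in S_M$ let $H^a$ be the space of tempered distributions $u$ on $\mathbb R$ whose Fourier transform is a function with $\|u\|_{H^a}^2=\langle u,a(D)u\rangle=\int a(\xi)|\hat u(\xi)|^2\,d\xi<\infty$, and put $$\|u\|_{H^{-1/2}_M}=\big\|(\xi^2+M^2)^{-1/4}\,\hat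 u\big\|_{L^2}.$$ Let $b_4:\mathbb R^4\to\mathbb R$ be any function such that $$\xi_1a(\xi_1)+\xi_2a(\xi_2)+\xi_3a(\xi_3)+\xi_4a(\xi_4)=b_4(\xi_1,\xi_2,\xi_3,\xi_4)\,(\xi_1^3+\xi_2^3+\xi_3^3+\xi_4^3)\quad\text{on }P_4,$$ and define the quartic energy correction $$E_1(u)=\int_{P_4} b_4(\xi_1,\xi_2,\xi_3,\xi_4)\,\hat u(\xi_1)\hat u(\xi_2)\hat u(\xi_3)\hat u(\xi_4)\,d\sigma .$$ **Corollary 5.3.** There is a constant $C>0$, depending only on the constants $(c_\alpha)$, such that for all $M\ge1$, all $a\in S_M$, all such $b_4$ and all $u\in H^a$, the integral defining $E_1(u)$ converges absolutely and $$|E_1(u)|\le C\,\|u\|_{H^a}^2\,\|u\|_{H^{-1/2}_M}^2 .$$ -/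

import Mathlib

open MeasureTheory
open scoped SchwartzMap FourierTransform ContDiff

namespace MKdV

/-- The class `S_M` of symbols, with a fixed sequence `c` of regularity constants:
smooth positive even functions on `ℝ`, constant on `[-M, M]`, with
`|∂^α a(ξ)| ≤ c_α a(ξ) ⟨ξ⟩^{-α}` and `-1/2 ≤ d log a(ξ) / d log (1 + ξ²) ≤ 0`. -/
structure SymbolClass (c : ℕ → ℝ) (M : ℝ) (a : ℝ → ℝ) : Prop where
  smooth : ContDiff ℝ ∞ a
  pos : ∀ ξ, 0 < a ξ
  even : ∀ ξ, a (-ξ) = a ξ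
  const_low : ∀ ξ, |ξ| ≤ M → a ξ = a 0
  regular : ∀ (α : ℕ) (ξ : ℝ), |iteratedDeriv α a ξ| ≤ c α * a ξ / √(1 + ξ ^ 2) ^ α
  /-- At `ξ = 0` the derivative of `log (1 + ξ²)` vanishes, and there `a` is locally constant. -/
  decay : ∀ ξ, ξ ≠ 0 →
    -(1 / 2) ≤ deriv (fun x => Real.log (a x)) ξ / deriv (fun x : ℝ => Real.log (1 + x ^ 2)) ξ ∧
    deriv (fun x => Real.log (a x)) ξ / deriv (fun x : ℝ => Real.log (1 + x ^ 2)) ξ ≤ 0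

/-- `v` is (a function representing) the Fourier transform of the tempered distribution `u`, in
the normalization `û(ξ) = (2π)^{-1/2} ∫ e^{-ixξ} u(x) dx`. Mathlib's `𝓕 u`, normalized as
`η ↦ ∫ e^{-2πixη} u(x) dx`, is then the function `η ↦ √(2π) û(2πη)`. -/
structure IsFourierTransform (u : 𝓢'(ℝ, ℂ)) (v : ℝ → ℂ) : Prop where
  aestronglyMeasurable : AEStronglyMeasurable v volume
  integrable : ∀ φ : 𝓢(ℝ, ℂ),
    Integrable (fun η : ℝ => φ η * ((√(2 * Real.pi) : ℂ) * v (2 * Real.pi * η)))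
  fourier_eq : ∀ φ : 𝓢(ℝ, ℂ),
    (𝓕 u) φ = ∫ η : ℝ, φ η * ((√(2 * Real.pi) : ℂ) * v (2 * Real.pi * η))

/-- The distribution with Fourier transform `v` lies in `H^a`: `⟨u, a(D) u⟩ = ∫ a |û|² < ∞`. -/
def MemHa (a : ℝ → ℝ) (v : ℝ → ℂ) : Prop :=
  Integrable (fun ξ : ℝ => a ξ * ‖v ξ‖ ^ 2)

/-- The norm of `H^a`, in terms of `v = û`: `‖u‖_{H^a}² = ⟨u, a(D) u⟩ = ∫ a |û|²`. -/
noncomputable def normHa (a : ℝ → ℝ) (v : ℝ → ℂ) : ℝ :=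
  √(∫ ξ : ℝ, a ξ * ‖v ξ‖ ^ 2)

/-- The norm of `H^s_M`, in terms of `v = û`: `‖(ξ² + M²)^{s/2} û‖_{L²}`. -/
noncomputable def normHsM (s M : ℝ) (v : ℝ → ℂ) : ℝ :=
  √(∫ ξ : ℝ, ((ξ ^ 2 + M ^ 2) ^ (s / 2) * ‖v ξ‖) ^ 2)

/-- `b₄` divides the symmetrized symbol of `a` by the resonance function on
`P₄ = {ξ₁ + ξ₂ + ξ₃ + ξ₄ = 0}`:
`ξ₁ a(ξ₁) + ⋯ + ξ₄ a(ξ₄) = b₄ (ξ₁³ + ⋯ + ξ₄³)` on `P₄`. -/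
def IsQuarticSymbol (a : ℝ → ℝ) (b₄ : (Fin 4 → ℝ) → ℝ) : Prop :=
  ∀ ξ : Fin 4 → ℝ, ∑ j, ξ j = 0 → ∑ j, ξ j * a (ξ j) = b₄ ξ * ∑ j, ξ j ^ 3

/-- The point of `P₄` with first three coordinates `η`. -/
def toP4 (η : Fin 3 → ℝ) : Fin 4 → ℝ :=
  ![η 0, η 1, η 2, -(η 0 + η 1 + η 2)]

/-- `b₄(ξ) û(ξ₁) û(ξ₂) û(ξ₃) û(ξ₄)`, restricted to `P₄`. -/
noncomputable def integrandE1 (b₄ : (Fin 4 → ℝ) → ℝ) (v : ℝ → ℂ) (η : Fin 3 → ℝ) : ℂ :=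
  (b₄ (toP4 η) : ℂ) * ∏ j, v (toP4 η j)

/-- `E₁(u) = ∫_{P₄} b₄(ξ) û(ξ₁) û(ξ₂) û(ξ₃) û(ξ₄) dσ`, with `dσ = δ(ξ₁ + ξ₂ + ξ₃ + ξ₄) dξ`, which
in the coordinates `(ξ₁, ξ₂, ξ₃)` of `P₄` is `dξ₁ dξ₂ dξ₃`. -/
noncomputable def E1 (b₄ : (Fin 4 → ℝ) → ℝ) (v : ℝ → ℂ) : ℂ :=
  ∫ η : Fin 3 → ℝ, integrandE1 b₄ v η

end MKdV

/-! On `P₄` the resonance function factors as `3 (x + p)(x + q)(x + r)`. Order the frequencies by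
`|p| ≤ |q| ≤ |r| ≤ |x|` and reflect so that `x > 0`. Off the zero set, `x + p` is comparable to `x`,
and the numerator is a second difference of the odd function `ξ a(ξ)` with steps `x + q` and `x +
r`. These steps cancel the other two factors, so `|b₄| ≲ a(q) / (x² + M²)` (`abs_quotient_le`).
Since `a(q) ≤ a(p)`, the inequality `2AB ≤ A² + B²` splits the integrand into terms `a|û|²` at one
frequency times `|û|²/√(·² + M²)` at a larger one, `s`, times `1/|s|`, with a third frequency
confined to `[-|s|, |s|]` (`mul_le_majorants`). Integrating that third frequency gives 2, and the
product of the two squared norms remains (`integral_majorant`). -/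

namespace MKdV

/-! ### Monotonicity of `a` and of `ξ a(ξ)`. -/

namespace SymbolClass

variable {c : ℕ → ℝ} {M : ℝ} {a : ℝ → ℝ}

theorem differentiable (h : SymbolClass c M a) : Differentiable ℝ a :=
  h.smooth.differentiable (by simp)

/-- The decay condition reads `-x²/(1 + x²) · a ≤ x a' ≤ 0`; the exponent `-1/2` is exactly what
keeps `ξ a(ξ)` nondecreasing. -/
theorem deriv_bounds (h : SymbolClass c M a) {x : ℝ} (hx : 0 < x) :
    deriv a x ≤ 0 ∧ 0 ≤ a x + x * deriv a x := by
  have hlog : deriv (fun y => Real.log (a y)) x = deriv a x / a x :=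
    ((h.differentiable x).hasDerivAt.log (h.pos x).ne').deriv
  have hx2 : 0 < 1 + x ^ 2 := by positivity
  have hlog2 : deriv (fun y : ℝ => Real.log (1 + y ^ 2)) x = 2 * x / (1 + x ^ 2) := by
    have h1 : HasDerivAt (fun y : ℝ => 1 + y ^ 2) (2 * x) x := by
      simpa using (hasDerivAt_pow 2 x).const_add 1
    exact (h1.log hx2.ne').deriv
  have hd := h.decay x hx.ne'
  rw [hlog, hlog2] at hd
  obtain ⟨h1, h2⟩ := hd
  have ha := h.pos x
  have hw : 0 < 2 * x / (1 + x ^ 2) := by positivity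
  rw [le_div_iff₀ hw, le_div_iff₀ ha] at h1
  rw [div_le_iff₀ hw, zero_mul, div_le_iff₀ ha, zero_mul] at h2
  refine ⟨h2, ?_⟩
  have h3 : x * (-(1 / 2) * (2 * x / (1 + x ^ 2)) * a x) ≤ x * deriv a x :=
    mul_le_mul_of_nonneg_left h1 hx.le
  have h4 : x * (-(1 / 2) * (2 * x / (1 + x ^ 2)) * a x) = - (x ^ 2 / (1 + x ^ 2) * a x) := by
    ring
  have h5 : x ^ 2 / (1 + x ^ 2) * a x ≤ 1 * a x := by
    refine mul_le_mul_of_nonneg_right ?_ ha.le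
    rw [div_le_one hx2]; linarith
  linarith

theorem antitoneOn (h : SymbolClass c M a) : AntitoneOn a (Set.Ici 0) := by
  refine antitoneOn_of_deriv_nonpos (convex_Ici 0) h.differentiable.continuous.continuousOn
    h.differentiable.differentiableOn fun x hx => ?_
  rw [interior_Ici] at hx
  exact (h.deriv_bounds hx).1

theorem hasDerivAt_mul (h : SymbolClass c M a) (x : ℝ) :
    HasDerivAt (fun y => y * a y) (a x + x * deriv a x) x := by
  convert! (hasDerivAt_id x).mul (h.differentiable x).hasDerivAt using 1
  simp

theorem monotoneOn_mul (h : SymbolClass c M a) : MonotoneOn (fun x => x * a x) (Set.Ici 0) := by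
  refine monotoneOn_of_deriv_nonneg (convex_Ici 0)
    (continuous_id.mul h.differentiable.continuous).continuousOn
    (differentiable_id.mul h.differentiable).differentiableOn fun x hx => ?_
  rw [interior_Ici] at hx
  rw [(h.hasDerivAt_mul x).deriv]
  exact (h.deriv_bounds hx).2

theorem apply_abs (h : SymbolClass c M a) (x : ℝ) : a |x| = a x := by
  rcases abs_choice x with hx | hx <;> simp [hx, h.even]

theorem le_of_abs_le (h : SymbolClass c M a) {x y : ℝ} (hxy : |x| ≤ |y|) : a y ≤ a x := by
  rw [← h.apply_abs x, ← h.apply_abs y]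
  exact h.antitoneOn (abs_nonneg x) (abs_nonneg y) hxy

theorem mul_le_mul' (h : SymbolClass c M a) {x y : ℝ} (hx : 0 ≤ x) (hxy : x ≤ y) :
    x * a x ≤ y * a y :=
  h.monotoneOn_mul hx (hx.trans hxy) hxy

/-- The symbol decays at most like `⟨ξ⟩⁻¹`. -/
theorem inv_sqrt_le (h : SymbolClass c M a) (hM : 1 ≤ M) (x : ℝ) :
    1 / √(x ^ 2 + M ^ 2) ≤ a x / a 0 := by
  have h0 := h.pos 0
  have hs : 0 < √(x ^ 2 + M ^ 2) := Real.sqrt_pos.2 (by positivity)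
  have h1 : 1 ≤ √(x ^ 2 + M ^ 2) := Real.one_le_sqrt.2 (by nlinarith [sq_nonneg x])
  rw [div_le_div_iff₀ hs h0, one_mul]
  rcases le_total |x| 1 with hx | hx
  · rw [h.const_low x (hx.trans hM)]
    nlinarith
  · have h2 : |x| ≤ √(x ^ 2 + M ^ 2) := Real.abs_le_sqrt (by nlinarith)
    have h3 := h.mul_le_mul' zero_le_one hx
    rw [h.const_low 1 (by simpa using hM), h.apply_abs] at h3
    nlinarith [h.pos x]

theorem sub_mul_nonneg (h : SymbolClass c M a) {y t : ℝ} (ht : 0 ≤ t) (hty : t ≤ 2 * y) :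
    0 ≤ y * a y - (y - t) * a (y - t) ∧ y * a y - (y - t) * a (y - t) ≤ 2 * t * a y := by
  have hay := h.pos y
  rcases le_total t y with hle | hle
  · have h1 := h.mul_le_mul' (sub_nonneg.2 hle) (sub_le_self y ht)
    have h2 : a y ≤ a (y - t) := h.le_of_abs_le (by
      rw [abs_of_nonneg (sub_nonneg.2 hle), abs_of_nonneg (ht.trans hle)]; linarith)
    refine ⟨by linarith, ?_⟩
    nlinarith [mul_le_mul_of_nonneg_left h2 (sub_nonneg.2 hle), mul_nonneg ht hay.le]
  · have h1 := h.mul_le_mul' (sub_nonneg.2 hle) (show t - y ≤ y by linarith)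
    have h3 : a (y - t) = a (t - y) := by rw [← h.even]; ring_nf
    -- Here `y - t ≤ 0`, and oddness turns the difference into a sum of two terms, each at most `y
    -- a(y) ≤ t a(y)`.
    have h4 : 0 ≤ (t - y) * a (t - y) := mul_nonneg (sub_nonneg.2 hle) (h.pos _).le
    have h5 : 0 ≤ y * a y := mul_nonneg (by linarith) hay.le
    rw [h3]
    refine ⟨by linarith, ?_⟩
    nlinarith [mul_le_mul_of_nonneg_right hle hay.le]

/-! ### Second differences of `ξ a(ξ)` and the size of `b₄`. -/

theorem hasDerivAt_deriv_mul (h : SymbolClass c M a) (x : ℝ) :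
    HasDerivAt (fun y => a y + y * deriv a y) (2 * deriv a x + x * iteratedDeriv 2 a x) x := by
  have h2 : ContDiff ℝ 1 (deriv a) := by
    have h3 : ContDiff ℝ (1 + 1) a := h.smooth.of_le (by norm_cast)
    exact (contDiff_succ_iff_deriv.1 h3).2.2
  have h1 : HasDerivAt (deriv a) (iteratedDeriv 2 a x) x := by
    rw [iteratedDeriv_succ, iteratedDeriv_one]
    exact (h2.differentiable (by simp) x).hasDerivAt
  convert! (h.differentiable x).hasDerivAt.add ((hasDerivAt_id x).mul h1) using 1
  simp; ring

theorem abs_second_deriv_mul_le (h : SymbolClass c M a) {x : ℝ} (hx : 0 < x) :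
    |2 * deriv a x + x * iteratedDeriv 2 a x| ≤ (2 * |c 1| + |c 2|) * (a x / x) := by
  have ha := h.pos x
  have h1 := h.regular 1 x
  have h2 := h.regular 2 x
  rw [iteratedDeriv_one, pow_one] at h1
  have hs : x ≤ √(1 + x ^ 2) := Real.le_sqrt_of_sq_le (by linarith)
  have h3 : |deriv a x| ≤ |c 1| * (a x / x) := by
    refine h1.trans ?_
    calc c 1 * a x / √(1 + x ^ 2) ≤ |c 1| * a x / √(1 + x ^ 2) := by
          gcongr; exact le_abs_self _
      _ ≤ |c 1| * a x / x := by gcongr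
      _ = _ := by ring
  have h4 : x * |iteratedDeriv 2 a x| ≤ |c 2| * (a x / x) := by
    calc x * |iteratedDeriv 2 a x| ≤ x * (|c 2| * a x / x ^ 2) := by
          gcongr
          refine h2.trans ?_
          calc c 2 * a x / √(1 + x ^ 2) ^ 2 ≤ |c 2| * a x / √(1 + x ^ 2) ^ 2 := by
                gcongr; exact le_abs_self _
            _ ≤ |c 2| * a x / x ^ 2 := by gcongr
      _ = _ := by field_simp
  calc _ ≤ |2 * deriv a x| + |x * iteratedDeriv 2 a x| := abs_add_le _ _
    _ = 2 * |deriv a x| + x * |iteratedDeriv 2 a x| := by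
        rw [abs_mul, abs_mul, abs_of_pos hx, abs_two]
    _ ≤ _ := by linarith

/-- The second difference of `ξ a(ξ)` with steps that are small relative to the base point. -/
theorem abs_second_difference_le (h : SymbolClass c M a) {x s t : ℝ} (hx : 0 < x) (ht : 0 ≤ t)
    (hts : t ≤ s) (hs : s ≤ x / 4) :
    |(x * a x - (x - t) * a (x - t)) - ((x - s) * a (x - s) - (x - s - t) * a (x - s - t))| ≤
      4 * (2 * |c 1| + |c 2|) * (a x / x) * t * s := by
  set K := 4 * (2 * |c 1| + |c 2|) * (a x / x) with hK
  have hax := h.pos x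
  -- All points involved lie in `[x - s - t, x] ⊆ [x/2, x]`, where `a(y)/y ≤ 4 a(x)/x`; the mean
  -- value inequality is then applied once per step.
  have hsecond : ∀ y ∈ Set.Icc (x / 2) x, ‖2 * deriv a y + y * iteratedDeriv 2 a y‖ ≤ K := by
    intro y hy
    have hy0 : 0 < y := by linarith [hy.1]
    have h1 : a y ≤ a (x / 2) := h.antitoneOn (Set.mem_Ici.2 (by linarith)) hy0.le hy.1
    have h2 := h.mul_le_mul' (show 0 ≤ x / 2 by linarith) (show x / 2 ≤ x by linarith)
    have h3 : a y ≤ 2 * a x := by nlinarith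
    refine (h.abs_second_deriv_mul_le hy0).trans ?_
    have h4 : a y / y ≤ 4 * (a x / x) := by
      calc a y / y ≤ (2 * a x) / (x / 2) := by
            gcongr; exact hy.1
        _ = _ := by field_simp; norm_num
    calc _ ≤ (2 * |c 1| + |c 2|) * (4 * (a x / x)) := by gcongr
      _ = K := by rw [hK]; ring
  have hfirst : ∀ y ∈ Set.Icc (x - s) x,
      ‖(a y + y * deriv a y) - (a (y - t) + (y - t) * deriv a (y - t))‖ ≤ K * t := by
    intro y hy
    have := (convex_Icc (x / 2) x).norm_image_sub_le_of_norm_hasDerivWithin_le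
      (fun z _ => (h.hasDerivAt_deriv_mul z).hasDerivWithinAt) hsecond
      (show y - t ∈ Set.Icc (x / 2) x from ⟨by linarith [hy.1], by linarith [hy.2]⟩)
      (show y ∈ Set.Icc (x / 2) x from ⟨by linarith [hy.1], by linarith [hy.2]⟩)
    simpa [abs_of_nonneg ht] using this
  have hder : ∀ y, HasDerivAt (fun y => y * a y - (y - t) * a (y - t))
      ((a y + y * deriv a y) - (a (y - t) + (y - t) * deriv a (y - t))) y := fun y =>
    (h.hasDerivAt_mul y).sub ((h.hasDerivAt_mul (y - t)).comp_sub_const y t)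
  have := (convex_Icc (x - s) x).norm_image_sub_le_of_norm_hasDerivWithin_le
    (fun z _ => (hder z).hasDerivWithinAt) hfirst
    (show x - s ∈ Set.Icc (x - s) x from ⟨le_rfl, by linarith⟩)
    (show x ∈ Set.Icc (x - s) x from ⟨by linarith, le_rfl⟩)
  simpa [abs_of_nonneg (ht.trans hts)] using this

/-- For `s ≥ x/4` the second cancellation is not needed: both first differences lie in `[0, 2 t a(x
- s)]`, and `4s/x ≥ 1` supplies the missing factor. -/
theorem abs_symmetrized_le (h : SymbolClass c M a) {x s t : ℝ} (hx : 0 < x) (ht : 0 ≤ t)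
    (hts : t ≤ s) (hst : 2 * s + t ≤ 2 * x) :
    |(x * a x - (x - t) * a (x - t)) - ((x - s) * a (x - s) - (x - s - t) * a (x - s - t))| ≤
      (4 * (2 * |c 1| + |c 2|) + 8) * (a (x - s) / x) * t * s := by
  have hxs := h.pos (x - s)
  have hs : 0 ≤ s := ht.trans hts
  have ha : a x ≤ a (x - s) := h.le_of_abs_le (by
    rw [abs_of_nonneg (by linarith), abs_of_pos hx]; linarith)
  rcases le_total s (x / 4) with hsx | hsx
  · refine (h.abs_second_difference_le hx ht hts hsx).trans ?_
    have : 0 ≤ a x / x := div_nonneg (h.pos x).le hx.le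
    gcongr
    linarith
  · obtain ⟨h1, h2⟩ := h.sub_mul_nonneg (y := x) ht (by linarith)
    obtain ⟨h3, h4⟩ := h.sub_mul_nonneg (y := x - s) ht (by linarith)
    have h5 : 2 * t * a x ≤ 2 * t * a (x - s) := by gcongr
    calc _ ≤ 2 * t * a (x - s) := by rw [abs_le]; constructor <;> linarith
      _ ≤ 2 * t * a (x - s) * (4 * s / x) := by
          refine le_mul_of_one_le_right (by positivity) ?_
          rw [le_div_iff₀ hx]; linarith
      _ = 8 * (a (x - s) / x) * t * s := by ring
      _ ≤ _ := by
          gcongr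
          linarith [abs_nonneg (c 1), abs_nonneg (c 2)]

theorem abs_quotient_le_of_pos (h : SymbolClass c M a) (hM : 1 ≤ M) {p q r x b : ℝ}
    (hpq : |p| ≤ |q|) (hqr : |q| ≤ |r|) (hrx : |r| ≤ |x|) (hsum : p + q + r + x = 0) (hx : 0 < x)
    (hcube : p ^ 3 + q ^ 3 + r ^ 3 + x ^ 3 ≠ 0)
    (hb : p * a p + q * a q + r * a r + x * a x = b * (p ^ 3 + q ^ 3 + r ^ 3 + x ^ 3)) :
    |b| ≤ (4 * (2 * |c 1| + |c 2|) + 8) * (a q / (x ^ 2 + M ^ 2)) := by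
  have hp : p = -(q + r + x) := by linarith
  have hfac : p ^ 3 + q ^ 3 + r ^ 3 + x ^ 3 = 3 * ((x + p) * ((x + r) * (x + q))) := by
    rw [hp]; ring
  have haq := h.pos q
  rw [abs_of_pos hx] at hrx
  have hxp : x + p ≠ 0 := fun h0 => hcube (by rw [hfac, h0]; ring)
  have hxq : x + q ≠ 0 := fun h0 => hcube (by rw [hfac, h0]; ring)
  have hxr : x + r ≠ 0 := fun h0 => hcube (by rw [hfac, h0]; ring)
  have hq1 := neg_abs_le q
  have hp1 := neg_abs_le p
  have hr1 := neg_abs_le r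
  have hxq' : 0 < x + q := lt_of_le_of_ne (by linarith) hxq.symm
  have hxr' : 0 < x + r := lt_of_le_of_ne (by linarith) hxr.symm
  -- If `r > 0`, the ordering and the zero sum force `r = x` and `p = q = -x`, which is resonant.
  have hr0 : r ≤ 0 := by
    by_contra! hr
    rw [abs_of_pos hr] at *
    exact hxq (by linarith)
  rw [abs_of_nonpos hr0] at *
  have hqp : q ≤ p := by
    by_contra! hlt
    rcases le_total q 0 with hq | hq
    · rw [abs_of_nonpos hq, abs_of_nonpos (by linarith)] at hpq
      linarith
    · rw [abs_of_nonneg hq] at *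
      exact hxr (by linarith)
  -- `p` is the largest of three numbers with sum `-x`, so `p ≥ -x/3`.
  have hxp' : 2 * x ≤ 3 * (x + p) := by linarith
  rcases lt_or_ge x M with hxM | hxM
  -- All four frequencies lie where `a` is constant, so the numerator is `a(0)` times their sum,
  -- which is zero.
  · have hz : ∀ y, |y| ≤ x → a y = a 0 := fun y hy => h.const_low y (by linarith)
    rw [hz p (by linarith), hz q (by linarith), hz r (by rw [abs_of_nonpos hr0]; linarith),
      hz x (by rw [abs_of_pos hx]), ← add_mul, ← add_mul, ← add_mul, hsum, zero_mul] at hb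
    have hb0 : b = 0 := by
      rcases mul_eq_zero.1 hb.symm with h0 | h0
      · exact h0
      · exact absurd h0 hcube
    rw [hb0, abs_zero]
    positivity
  -- The condition `2s + t ≤ 2x` amounts to `q ≤ p`.
  · have hF := h.abs_symmetrized_le (s := x + q) (t := x + r) hx hxr'.le (by linarith)
      (by linarith)
    set K := 4 * (2 * |c 1| + |c 2|) + 8 with hK
    have e1 : x - (x + r) = -r := by ring
    have e2 : x - (x + q) = -q := by ring
    have e3 : -q - (x + r) = p := by linarith
    rw [e1, e2, e3, h.even, h.even] at hF
    have hF' : x * a x - -r * a r - (-q * a q - p * a p)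
        = b * (3 * ((x + p) * ((x + r) * (x + q)))) := by
      rw [← hfac, ← hb]; ring
    have hst : 0 < (x + r) * (x + q) := mul_pos hxr' hxq'
    rw [hF', abs_mul, abs_of_pos (a := 3 * _) (by
      have : 0 < x + p := by linarith
      positivity)] at hF
    have hF2 : (|b| * (3 * (x + p))) * ((x + r) * (x + q))
        ≤ (K * (a q / x)) * ((x + r) * (x + q)) := by
      calc _ = _ := by ring
        _ ≤ _ := hF
        _ = _ := by ring
    have hF3 := le_of_mul_le_mul_right hF2 hst
    have hF4 : |b| * (2 * x) ≤ K * (a q / x) :=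
      (mul_le_mul_of_nonneg_left hxp' (abs_nonneg b)).trans hF3
    have hF5 : |b| * (2 * x ^ 2) ≤ K * a q := by
      calc |b| * (2 * x ^ 2) = |b| * (2 * x) * x := by ring
        _ ≤ K * (a q / x) * x := by gcongr
        _ = K * a q := by field_simp
    have hxM2 : x ^ 2 + M ^ 2 ≤ 2 * x ^ 2 := by nlinarith
    rw [← mul_div_assoc, le_div_iff₀ (by positivity)]
    exact (mul_le_mul_of_nonneg_left hxM2 (abs_nonneg b)).trans hF5

/-- The pointwise bound of the quartic symbol at frequencies ordered by their size. -/
theorem abs_quotient_le (h : SymbolClass c M a) (hM : 1 ≤ M) {p q r x b : ℝ}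
    (hpq : |p| ≤ |q|) (hqr : |q| ≤ |r|) (hrx : |r| ≤ |x|) (hsum : p + q + r + x = 0)
    (hcube : p ^ 3 + q ^ 3 + r ^ 3 + x ^ 3 ≠ 0)
    (hb : p * a p + q * a q + r * a r + x * a x = b * (p ^ 3 + q ^ 3 + r ^ 3 + x ^ 3)) :
    |b| ≤ (4 * (2 * |c 1| + |c 2|) + 8) * (a q / (x ^ 2 + M ^ 2)) := by
  rcases lt_trichotomy x 0 with hx | hx | hx
  · have := h.abs_quotient_le_of_pos hM (p := -p) (q := -q) (r := -r) (x := -x) (b := b)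
      (by simpa using hpq) (by simpa using hqr) (by simpa using hrx) (by linarith) (by linarith)
      (fun h0 => hcube (by linear_combination -h0))
      (by simp only [h.even]; linear_combination -hb)
    simpa [h.even] using this
  · subst hx
    rw [abs_zero] at hrx
    have hr : r = 0 := abs_nonpos_iff.1 hrx
    have hq : q = 0 := abs_nonpos_iff.1 (hqr.trans hrx)
    exact absurd (by rw [hr, hq, show p = 0 by linarith]; norm_num) hcube
  · exact h.abs_quotient_le_of_pos hM hpq hqr hrx hsum hx hcube hb

end SymbolClass

/-! ### The majorant and its integral. -/

/-- The kernel `1_{|t| ≤ |s|} / |s|`, of constant integral in `t`. -/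
noncomputable def avgKernel (s t : ℝ) : ℝ := if |t| ≤ |s| then |s|⁻¹ else 0

theorem avgKernel_nonneg (s t : ℝ) : 0 ≤ avgKernel s t := by
  unfold avgKernel; split_ifs <;> positivity

theorem measurable_avgKernel : Measurable fun z : ℝ × ℝ => avgKernel z.1 z.2 := by
  unfold avgKernel
  refine Measurable.ite (measurableSet_le ?_ ?_) ?_ measurable_const <;> fun_prop

theorem avgKernel_eq_indicator (s : ℝ) :
    avgKernel s = (Set.Icc (-|s|) |s|).indicator fun _ => |s|⁻¹ := by
  ext t
  simp only [avgKernel, Set.indicator_apply, Set.mem_Icc, abs_le]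

theorem integrable_avgKernel (s : ℝ) : Integrable (avgKernel s) := by
  rw [avgKernel_eq_indicator]
  exact (integrable_indicator_iff measurableSet_Icc).2 (integrableOn_const (by simp))

theorem integral_avgKernel {s : ℝ} (hs : s ≠ 0) : ∫ t, avgKernel s t = 2 := by
  have h : 0 < |s| := abs_pos.2 hs
  rw [avgKernel_eq_indicator, integral_indicator measurableSet_Icc, setIntegral_const,
    Real.volume_real_Icc_of_le (by linarith), smul_eq_mul]
  field_simp
  norm_num

theorem integrable_mul_avgKernel {H : ℝ → ℝ} (hH : Integrable H) :
    Integrable fun z : ℝ × ℝ => H z.1 * avgKernel z.1 z.2 := by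
  have hm : AEStronglyMeasurable (fun z : ℝ × ℝ => H z.1 * avgKernel z.1 z.2)
      (volume.prod volume) := hH.1.comp_fst.mul measurable_avgKernel.aestronglyMeasurable
  rw [Measure.volume_eq_prod, integrable_prod_iff hm]
  refine ⟨.of_forall fun s => (integrable_avgKernel s).const_mul (H s), ?_⟩
  refine (hH.norm.mul_const 2).congr ?_
  filter_upwards [Measure.ae_ne volume (0 : ℝ)] with s hs
  simp only [norm_mul, Real.norm_of_nonneg (avgKernel_nonneg _ _)]
  rw [integral_const_mul, integral_avgKernel hs]

theorem integral_mul_avgKernel {H : ℝ → ℝ} (hH : Integrable H) :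
    ∫ z : ℝ × ℝ, H z.1 * avgKernel z.1 z.2 = 2 * ∫ s, H s := by
  have h := integrable_mul_avgKernel hH
  rw [Measure.volume_eq_prod] at h ⊢
  rw [integral_prod _ h, ← integral_const_mul]
  refine integral_congr_ae ?_
  filter_upwards [Measure.ae_ne volume (0 : ℝ)] with s hs
  rw [integral_const_mul, integral_avgKernel hs, mul_comm]

/-- The trilinear majorant `G(y₀) H(y₁) 1_{|y₂| ≤ |y₁|} / |y₁|`. -/
noncomputable def majorant (G H : ℝ → ℝ) (y : Fin 3 → ℝ) : ℝ :=
  G (y 0) * (H (y 1) * avgKernel (y 1) (y 2))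

/-- Splitting `ℝ³` as `ℝ × (ℝ × ℝ)`. -/
def splitThree : (Fin 3 → ℝ) ≃ᵐ ℝ × (ℝ × ℝ) :=
  (MeasurableEquiv.piFinSuccAbove (fun _ => ℝ) 0).trans
    ((MeasurableEquiv.refl ℝ).prodCongr MeasurableEquiv.finTwoArrow)

theorem measurePreserving_splitThree : MeasurePreserving splitThree :=
  ((MeasurePreserving.id volume).prod (volume_preserving_finTwoArrow ℝ)).comp
    (volume_preserving_piFinSuccAbove (fun _ : Fin 3 => ℝ) 0)

theorem majorant_eq (G H : ℝ → ℝ) : majorant G H =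
    (fun z : ℝ × (ℝ × ℝ) => G z.1 * (H z.2.1 * avgKernel z.2.1 z.2.2)) ∘ splitThree := rfl

theorem integrable_majorant {G H : ℝ → ℝ} (hG : Integrable G) (hH : Integrable H) :
    Integrable (majorant G H) := by
  rw [majorant_eq, measurePreserving_splitThree.integrable_comp_emb
    splitThree.measurableEmbedding]
  exact hG.mul_prod (integrable_mul_avgKernel hH)

theorem integral_majorant {G H : ℝ → ℝ} (hH : Integrable H) :
    ∫ y, majorant G H y = 2 * ((∫ x, G x) * ∫ x, H x) := by
  rw [majorant_eq]
  refine (measurePreserving_splitThree.integral_comp splitThree.measurableEmbedding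
    fun z : ℝ × (ℝ × ℝ) => G z.1 * (H z.2.1 * avgKernel z.2.1 z.2.2)).trans ?_
  refine (integral_prod_mul G fun z : ℝ × ℝ => H z.1 * avgKernel z.1 z.2).trans ?_
  rw [integral_mul_avgKernel hH]
  ring

/-! ### Coordinates on `P₄` and the null resonant set. -/

/-- The coefficients of the four frequencies in the coordinates of `toP4`. -/
def coordMatrix : Matrix (Fin 4) (Fin 3) ℤ := !![1, 0, 0; 0, 1, 0; 0, 0, 1; -1, -1, -1]

theorem det_coordMatrix : ∀ e : Fin 3 → Fin 4, Function.Injective e →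
    (coordMatrix.submatrix e id).det = 1 ∨ (coordMatrix.submatrix e id).det = -1 := by
  simp only [Matrix.det_fin_three]
  decide

/-- Any three of the four frequencies are unimodular coordinates on `P₄`, so majorants attached to
different triples have the same integral. -/
theorem measurePreserving_toP4 {e : Fin 3 → Fin 4} (he : Function.Injective e) :
    MeasurePreserving fun η k => toP4 η (e k) := by
  set A : Matrix (Fin 3) (Fin 3) ℝ := (coordMatrix.submatrix e id).map (Int.castRingHom ℝ) with hA
  have hdet : |A.det| = 1 := by
    rw [hA, ← RingHom.mapMatrix_apply, ← RingHom.map_det]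
    rcases det_coordMatrix e he with h | h <;> simp [h]
  have hfun : (fun η k => toP4 η (e k)) = Matrix.toLin' A := by
    ext η k
    rw [Matrix.toLin'_apply, Matrix.mulVec, dotProduct, Fin.sum_univ_three, hA]
    simp only [Matrix.map_apply, Matrix.submatrix_apply, id]
    generalize e k = j
    fin_cases j <;> simp [toP4, coordMatrix]
    ring
  rw [hfun]
  refine ⟨(Matrix.toLin' A).continuous_of_finiteDimensional.measurable, ?_⟩
  rw [Real.map_matrix_volume_pi_eq_smul_volume_pi (by
    intro h; rw [h] at hdet; simp at hdet), abs_inv, hdet]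
  simp

theorem ae_toP4_add_ne_zero {i j : Fin 4} (hij : i ≠ j) :
    ∀ᵐ η : Fin 3 → ℝ, toP4 η i + toP4 η j ≠ 0 := by
  obtain ⟨e, he, h0, h1⟩ : ∃ e : Fin 3 → Fin 4, Function.Injective e ∧ e 0 = i ∧ e 1 = j := by
    revert i j; decide
  have key : ∀ᵐ y : Fin 3 → ℝ, y 0 + y 1 ≠ 0 := by
    have := Measure.addHaar_submodule (volume : Measure (Fin 3 → ℝ))
      (LinearMap.ker ((LinearMap.proj 0 : (Fin 3 → ℝ) →ₗ[ℝ] ℝ) +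
        (LinearMap.proj 1 : (Fin 3 → ℝ) →ₗ[ℝ] ℝ))) (by
        intro h
        have h2 : (fun _ => 1 : Fin 3 → ℝ) ∈ (⊤ : Submodule ℝ (Fin 3 → ℝ)) := trivial
        rw [← h] at h2
        have h3 : (1 : ℝ) + 1 = 0 := LinearMap.mem_ker.1 h2
        norm_num at h3)
    rw [ae_iff]
    convert this using 2
    ext y
    simp
  have := (measurePreserving_toP4 he).quasiMeasurePreserving.ae key
  simpa only [h0, h1] using this

theorem sum_cube_toP4 (η : Fin 3 → ℝ) : ∑ j, toP4 η j ^ 3 =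
    -3 * ((toP4 η 0 + toP4 η 1) * (toP4 η 0 + toP4 η 2) * (toP4 η 1 + toP4 η 2)) := by
  simp [Fin.sum_univ_four, toP4]; ring

theorem sum_toP4 (η : Fin 3 → ℝ) : ∑ j, toP4 η j = 0 := by
  simp [Fin.sum_univ_four, toP4]

theorem ae_sum_cube_toP4_ne_zero : ∀ᵐ η : Fin 3 → ℝ, ∑ j, toP4 η j ^ 3 ≠ 0 := by
  filter_upwards [ae_toP4_add_ne_zero (show (0 : Fin 4) ≠ 1 by decide),
    ae_toP4_add_ne_zero (show (0 : Fin 4) ≠ 2 by decide),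
    ae_toP4_add_ne_zero (show (1 : Fin 4) ≠ 2 by decide)] with η h1 h2 h3
  rw [sum_cube_toP4]
  positivity

theorem quasiMeasurePreserving_toP4 (j : Fin 4) :
    Measure.QuasiMeasurePreserving fun η => toP4 η j := by
  obtain ⟨e, he, h0⟩ : ∃ e : Fin 3 → Fin 4, Function.Injective e ∧ e 0 = j := by
    revert j; decide
  have := (Measure.quasiMeasurePreserving_eval (fun _ : Fin 3 => (volume : Measure ℝ)) 0).comp
    (measurePreserving_toP4 he).quasiMeasurePreserving
  subst h0
  exact this

/-- `b₄` is arbitrary on the resonant set, but that set is null, and elsewhere `b₄` is a quotient of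
measurable functions. -/
theorem aestronglyMeasurable_integrandE1 {a : ℝ → ℝ} (ha : Measurable a) {b₄ : (Fin 4 → ℝ) → ℝ}
    (hb : IsQuarticSymbol a b₄) {v : ℝ → ℂ} (hv : AEStronglyMeasurable v) :
    AEStronglyMeasurable (integrandE1 b₄ v) := by
  have hm : ∀ j, Measurable fun η => toP4 η j := fun j => (quasiMeasurePreserving_toP4 j).measurable
  have h1 : AEStronglyMeasurable fun η : Fin 3 → ℝ =>
      ((((∑ j, toP4 η j * a (toP4 η j)) / ∑ j, toP4 η j ^ 3 : ℝ) : ℂ) * ∏ j, v (toP4 η j)) := by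
    refine AEStronglyMeasurable.mul ?_ ?_
    · refine Measurable.aestronglyMeasurable ?_
      refine Complex.measurable_ofReal.comp (Measurable.div ?_ ?_)
      · exact Finset.measurable_sum _ fun j _ => (hm j).mul (ha.comp (hm j))
      · exact Finset.measurable_sum _ fun j _ => (hm j).pow_const 3
    · exact Finset.aestronglyMeasurable_fun_prod _ fun j _ =>
        hv.comp_quasiMeasurePreserving (quasiMeasurePreserving_toP4 j)
  refine h1.congr ?_
  filter_upwards [ae_sum_cube_toP4_ne_zero] with η hη
  rw [integrandE1, hb _ (sum_toP4 η), mul_div_cancel_right₀ _ hη]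

/-! ### Pointwise domination of the integrand. -/

/-- The weight of the squared norm of `H^{-1/2}_M`. -/
theorem rpow_mul_sq {M : ℝ} (x w : ℝ) :
    ((x ^ 2 + M ^ 2) ^ (-(1 / 2) / 2 : ℝ) * w) ^ 2 = w ^ 2 / √(x ^ 2 + M ^ 2) := by
  have h : 0 ≤ x ^ 2 + M ^ 2 := by positivity
  rw [mul_pow, ← Real.rpow_natCast, ← Real.rpow_mul h, Real.sqrt_eq_rpow,
    div_eq_mul_inv (w ^ 2), ← Real.rpow_neg h, mul_comm]
  norm_num

/-- The pairing is `(p, r)` and `(q, x)`. Of the two factors `√(x² + M²)`, one becomes the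
`H^{-1/2}_M` weight at `r` or `x`, the other the normalization of the kernel. -/
theorem mul_le_majorants {a v : ℝ → ℝ} {M p q r x b K : ℝ} (hK : 0 ≤ K)
    (hap : 0 < a p) (haq : 0 < a q)
    (hpq : |p| ≤ |q|) (hqr : |q| ≤ |r|) (hrx : |r| ≤ |x|) (hr : r ≠ 0) (hqp : a q ≤ a p)
    (hb : |b| ≤ K * (a q / (x ^ 2 + M ^ 2))) :
    |b| * (|v p| * |v q| * |v r| * |v x|) ≤ K / 2 *
      ((a p * v p ^ 2) * ((v r ^ 2 / √(r ^ 2 + M ^ 2)) * avgKernel r q) +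
        (a q * v q ^ 2) * ((v x ^ 2 / √(x ^ 2 + M ^ 2)) * avgKernel x p)) := by
  have hr' : 0 < |r| := abs_pos.2 hr
  have hx' : 0 < |x| := hr'.trans_le hrx
  rw [avgKernel, if_pos hqr, avgKernel, if_pos ((hpq.trans hqr).trans hrx)]
  have hr2 : r ^ 2 ≤ x ^ 2 := sq_le_sq.2 hrx
  have hr0 : 0 < r ^ 2 := by positivity
  have hx0 : 0 < x ^ 2 := hr0.trans_le hr2
  have hsr : 0 < √(r ^ 2 + M ^ 2) := Real.sqrt_pos.2 (by positivity)
  have hsx : 0 < √(x ^ 2 + M ^ 2) := Real.sqrt_pos.2 (by positivity)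
  have hxs : |x| ≤ √(x ^ 2 + M ^ 2) := Real.abs_le_sqrt (by nlinarith [sq_nonneg M])
  have hrs : √(r ^ 2 + M ^ 2) ≤ √(x ^ 2 + M ^ 2) := Real.sqrt_le_sqrt (by linarith)
  have hsq : x ^ 2 + M ^ 2 = √(x ^ 2 + M ^ 2) * √(x ^ 2 + M ^ 2) :=
    (Real.mul_self_sqrt (by positivity)).symm
  have h1 : a q / (x ^ 2 + M ^ 2) ≤ a p / (√(r ^ 2 + M ^ 2) * |r|) := by
    rw [hsq]
    gcongr
    exact hrx.trans hxs
  have h2 : a q / (x ^ 2 + M ^ 2) ≤ a q / (√(x ^ 2 + M ^ 2) * |x|) := by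
    nth_rw 1 [hsq]
    gcongr
  have h3 : |v p| * |v q| * |v r| * |v x| ≤
      1 / 2 * (v p ^ 2 * v r ^ 2) + 1 / 2 * (v q ^ 2 * v x ^ 2) := by
    have := sq_nonneg (|v p| * |v r| - |v q| * |v x|)
    rw [← sq_abs (v p), ← sq_abs (v q), ← sq_abs (v r), ← sq_abs (v x)]
    nlinarith
  calc _ ≤ K * (a q / (x ^ 2 + M ^ 2)) *
        (1 / 2 * (v p ^ 2 * v r ^ 2) + 1 / 2 * (v q ^ 2 * v x ^ 2)) := by gcongr
    _ = K / 2 * ((a q / (x ^ 2 + M ^ 2)) * (v p ^ 2 * v r ^ 2)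
        + (a q / (x ^ 2 + M ^ 2)) * (v q ^ 2 * v x ^ 2)) := by ring
    _ ≤ K / 2 * ((a p / (√(r ^ 2 + M ^ 2) * |r|)) * (v p ^ 2 * v r ^ 2)
        + (a q / (√(x ^ 2 + M ^ 2) * |x|)) * (v q ^ 2 * v x ^ 2)) := by gcongr
    _ = _ := by field_simp

/-- The integrand of the quartic energy correction is dominated by the trilinear majorants
attached to the triples of distinct frequencies. -/
theorem norm_integrandE1_le {c : ℕ → ℝ} {M : ℝ} {a : ℝ → ℝ} (h : SymbolClass c M a) (hM : 1 ≤ M)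
    {b₄ : (Fin 4 → ℝ) → ℝ} (hb : IsQuarticSymbol a b₄) (v : ℝ → ℂ) {η : Fin 3 → ℝ}
    (hη : ∑ j, toP4 η j ^ 3 ≠ 0) :
    ‖integrandE1 b₄ v η‖ ≤ (4 * (2 * |c 1| + |c 2|) + 8) *
      ∑ e : Fin 3 ↪ Fin 4, majorant (fun x => a x * ‖v x‖ ^ 2)
        (fun x => ((x ^ 2 + M ^ 2) ^ (-(1 / 2) / 2 : ℝ) * ‖v x‖) ^ 2)
        (fun k => toP4 η (e k)) := by
  set K := 4 * (2 * |c 1| + |c 2|) + 8 with hK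
  set ξ := toP4 η with hξ
  set σ := Tuple.sort fun j => |ξ j| with hσ
  have hmono : Monotone fun j => |ξ (σ j)| := Tuple.monotone_sort fun j => |ξ j|
  have hsum : ξ (σ 0) + ξ (σ 1) + ξ (σ 2) + ξ (σ 3) = 0 := by
    rw [← Fin.sum_univ_four fun j => ξ (σ j), Equiv.sum_comp σ ξ]
    exact sum_toP4 η
  have hcube : ∑ j, ξ j ^ 3 = ξ (σ 0) ^ 3 + ξ (σ 1) ^ 3 + ξ (σ 2) ^ 3 + ξ (σ 3) ^ 3 := by
    rw [← Fin.sum_univ_four fun j => ξ (σ j) ^ 3, Equiv.sum_comp σ fun j => ξ j ^ 3]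
  have hnum : ∑ j, ξ j * a (ξ j) = ξ (σ 0) * a (ξ (σ 0)) + ξ (σ 1) * a (ξ (σ 1)) +
      ξ (σ 2) * a (ξ (σ 2)) + ξ (σ 3) * a (ξ (σ 3)) := by
    rw [← Fin.sum_univ_four fun j => ξ (σ j) * a (ξ (σ j)),
      Equiv.sum_comp σ fun j => ξ j * a (ξ j)]
  have hprod : ∏ j, ‖v (ξ j)‖ =
      ‖v (ξ (σ 0))‖ * ‖v (ξ (σ 1))‖ * ‖v (ξ (σ 2))‖ * ‖v (ξ (σ 3))‖ := by
    rw [← Fin.prod_univ_four fun j => ‖v (ξ (σ j))‖, Equiv.prod_comp σ fun j => ‖v (ξ j)‖]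
  have hquot := hb ξ (sum_toP4 η)
  rw [hcube] at hη
  rw [hnum, hcube] at hquot
  have h01 : |ξ (σ 0)| ≤ |ξ (σ 1)| := hmono (by decide)
  have h12 : |ξ (σ 1)| ≤ |ξ (σ 2)| := hmono (by decide)
  have h23 : |ξ (σ 2)| ≤ |ξ (σ 3)| := hmono (by decide)
  have hne : ξ (σ 2) ≠ 0 := by
    intro h0
    rw [h0, abs_zero] at h12
    have h1 : ξ (σ 1) = 0 := abs_nonpos_iff.1 h12
    rw [h1, abs_zero] at h01
    have h2 : ξ (σ 0) = 0 := abs_nonpos_iff.1 h01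
    have h3 : ξ (σ 3) = 0 := by linarith
    exact hη (by rw [h0, h1, h2, h3]; norm_num)
  have hK0 : 0 ≤ K := by positivity
  have hbound := mul_le_majorants (v := fun x => ‖v x‖) hK0 (h.pos _) (h.pos _) h01 h12 h23 hne
    (h.le_of_abs_le h01) (h.abs_quotient_le hM h01 h12 h23 hsum hη hquot)
  set G : ℝ → ℝ := fun x => a x * ‖v x‖ ^ 2 with hG
  set H : ℝ → ℝ := fun x => ((x ^ 2 + M ^ 2) ^ (-(1 / 2) / 2 : ℝ) * ‖v x‖) ^ 2 with hH
  have hnonneg : ∀ e : Fin 3 ↪ Fin 4, 0 ≤ majorant G H (fun k => ξ (e k)) := fun e =>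
    mul_nonneg (mul_nonneg (h.pos _).le (by positivity))
      (mul_nonneg (by positivity) (avgKernel_nonneg _ _))
  have hle : ∀ e : Fin 3 → Fin 4, Function.Injective e →
      majorant G H (fun k => ξ (σ (e k))) ≤
        ∑ e : Fin 3 ↪ Fin 4, majorant G H (fun k => ξ (e k)) := fun e he =>
    Finset.single_le_sum (f := fun e : Fin 3 ↪ Fin 4 => majorant G H (fun k => ξ (e k)))
      (fun e _ => hnonneg e) (Finset.mem_univ ⟨σ ∘ e, σ.injective.comp he⟩)
  -- Indices refer to increasing size: the `a`-weighted, the `H^{-1/2}_M`-weighted and the averaged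
  -- frequency, in this order. Summing over all embeddings removes the dependence on the sorting
  -- permutation.
  have hA := hle ![0, 2, 1] (by decide)
  have hB := hle ![1, 3, 0] (by decide)
  rw [integrandE1, norm_mul, norm_prod, Complex.norm_real, Real.norm_eq_abs, ← hξ, hprod]
  simp only [abs_norm, ← rpow_mul_sq] at hbound
  refine hbound.trans ?_
  calc _ = K / 2 * (majorant G H (fun k => ξ (σ (![0, 2, 1] k))) +
        majorant G H (fun k => ξ (σ (![1, 3, 0] k)))) := rfl
    _ ≤ K / 2 * ((∑ e : Fin 3 ↪ Fin 4, majorant G H (fun k => ξ (e k))) +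
        ∑ e : Fin 3 ↪ Fin 4, majorant G H (fun k => ξ (e k))) := by gcongr
    _ = _ := by ring

/-- `H^a` embeds into `H^{-1/2}_M`. -/
theorem SymbolClass.integrable_weight {c : ℕ → ℝ} {M : ℝ} {a : ℝ → ℝ} (h : SymbolClass c M a)
    (hM : 1 ≤ M) {v : ℝ → ℂ} (hv : AEStronglyMeasurable v) (hva : MemHa a v) :
    Integrable fun x : ℝ => ((x ^ 2 + M ^ 2) ^ (-(1 / 2) / 2 : ℝ) * ‖v x‖) ^ 2 := by
  have hmeas : Measurable fun x : ℝ => (x ^ 2 + M ^ 2) ^ (-(1 / 2) / 2 : ℝ) := by fun_prop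
  refine (Integrable.const_mul hva (a 0)⁻¹).mono' ((hmeas.aestronglyMeasurable.mul hv.norm).pow 2)
    (.of_forall fun x => ?_)
  rw [Real.norm_of_nonneg (by positivity), rpow_mul_sq]
  calc ‖v x‖ ^ 2 / √(x ^ 2 + M ^ 2) = ‖v x‖ ^ 2 * (1 / √(x ^ 2 + M ^ 2)) := by ring
    _ ≤ ‖v x‖ ^ 2 * (a x / a 0) := by
        exact mul_le_mul_of_nonneg_left (h.inv_sqrt_le hM x) (by positivity)
    _ = _ := by ring

end MKdV

theorem corollary5p3 (c : ℕ → ℝ) :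
    ∃ C : ℝ, 0 < C ∧
      ∀ (M : ℝ), 1 ≤ M →
      ∀ (a : ℝ → ℝ), MKdV.SymbolClass c M a →
      ∀ (b₄ : (Fin 4 → ℝ) → ℝ), MKdV.IsQuarticSymbol a b₄ →
      ∀ (u : 𝓢'(ℝ, ℂ)) (v : ℝ → ℂ), MKdV.IsFourierTransform u v → MKdV.MemHa a v →
        Integrable (MKdV.integrandE1 b₄ v) ∧
        ‖MKdV.E1 b₄ v‖ ≤ C * MKdV.normHa a v ^ 2 * MKdV.normHsM (-(1 / 2)) M v ^ 2 := by
  -- There are 24 embeddings of `Fin 3` into `Fin 4`, and each majorant carries the kernel mass 2.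
  refine ⟨(4 * (2 * |c 1| + |c 2|) + 8) * 48, by positivity, ?_⟩
  intro M hM a h b₄ hb u v hu hva
  have hv := hu.aestronglyMeasurable
  have hH := h.integrable_weight hM hv hva
  have hint : ∀ e : Fin 3 ↪ Fin 4, Integrable fun η : Fin 3 → ℝ =>
      MKdV.majorant (fun x => a x * ‖v x‖ ^ 2)
        (fun x => ((x ^ 2 + M ^ 2) ^ (-(1 / 2) / 2 : ℝ) * ‖v x‖) ^ 2)
        (fun k => MKdV.toP4 η (e k)) := fun e =>
    (MKdV.measurePreserving_toP4 e.injective).integrable_comp_of_integrable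
      (MKdV.integrable_majorant hva hH)
  have hval : ∀ e : Fin 3 ↪ Fin 4, ∫ η : Fin 3 → ℝ,
      MKdV.majorant (fun x => a x * ‖v x‖ ^ 2)
        (fun x => ((x ^ 2 + M ^ 2) ^ (-(1 / 2) / 2 : ℝ) * ‖v x‖) ^ 2)
        (fun k => MKdV.toP4 η (e k)) =
      2 * (MKdV.normHa a v ^ 2 * MKdV.normHsM (-(1 / 2)) M v ^ 2) := fun e => by
    have hmp := MKdV.measurePreserving_toP4 e.injective
    have hmaj := MKdV.integrable_majorant hva hH
    rw [MKdV.normHa, MKdV.normHsM, Real.sq_sqrt (integral_nonneg fun x =>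
      mul_nonneg (h.pos x).le (sq_nonneg _)), Real.sq_sqrt (integral_nonneg fun x => sq_nonneg _),
      ← MKdV.integral_majorant hH]
    conv_rhs => rw [← hmp.map_eq]
    rw [integral_map hmp.measurable.aemeasurable (by rw [hmp.map_eq]; exact hmaj.1)]
  have hdom := (integrable_finsetSum Finset.univ fun e _ => hint e).const_mul
    (4 * (2 * |c 1| + |c 2|) + 8)
  have hle : ∀ᵐ η : Fin 3 → ℝ, ‖MKdV.integrandE1 b₄ v η‖ ≤ _ :=
    MKdV.ae_sum_cube_toP4_ne_zero.mono fun η hη => MKdV.norm_integrandE1_le h hM hb v hη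
  refine ⟨hdom.mono' (MKdV.aestronglyMeasurable_integrandE1
    h.differentiable.continuous.measurable hb hv) hle, ?_⟩
  refine (norm_integral_le_of_norm_le hdom hle).trans_eq ?_
  rw [integral_const_mul, integral_finsetSum _ fun e _ => hint e,
    Finset.sum_congr rfl fun e _ => hval e, Finset.sum_const, Finset.card_univ,
    Fintype.card_embedding_eq]
  simp [Nat.descFactorial]
  ring
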